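/- For an endomorphism $\phi$ of a group $G$, call $x, y \in G$ $\phi$-conjugate if $x = z y \phi(z)^{-1}$ for some $z \in G$; this is an equivalence relation, and the Reidemeister number $R(\phi) \in \mathbb{N} \cup \{\infty\}$ is the number of its equivalence classes. Let $N$ be a finitely generated torsion-free nilpotent group and let $\phi \in \operatorname{End}(N)$. Suppose that $H$ is a subgroup of $N$ such that $\phi(H) \leq H$, and write $\phi|_H \in \operatorname{End}(H)$ for the induced endomorphism. If $R(\phi|_H) = \infty$, then $R(\phi) = \infty$. -/

import Mathlib

/-- The `φ`-twisted conjugacy relation on `G`: `x ∼ y` iff `x = z y φ(z)⁻¹` for some `z : G`. -/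
def twistedConjSetoid {G : Type*} [Group G] (φ : G →* G) : Setoid G where
  r x y := ∃ z : G, x = z * y * (φ z)⁻¹
  iseqv :=
    { refl := fun x => ⟨1, by simp⟩
      symm := by
        rintro x y ⟨z, rfl⟩
        exact ⟨z⁻¹, by simp [mul_assoc]⟩
      trans := by
        rintro x y w ⟨z, rfl⟩ ⟨z', rfl⟩
        exact ⟨z * z', by simp [mul_assoc]⟩ }

/-- The Reidemeister number `R(φ)`: the number of `φ`-twisted conjugacy classes, in `ℕ ∪ {∞}`. -/
noncomputable def reidemeisterNumber {G : Type*} [Group G] (φ : G →* G) : ℕ∞ :=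
  ENat.card (Quotient (twistedConjSetoid φ))

/-- The endomorphism of a subgroup `H` with `φ(H) ≤ H` obtained by restricting `φ`. -/
def restrictEnd {G : Type*} [Group G] (φ : G →* G) (H : Subgroup G) (hH : H.map φ ≤ H) :
    H →* H :=
  (φ.comp H.subtype).codRestrict H fun h => hH (Subgroup.mem_map_of_mem φ h.2)

/-! ### Subgroups of finitely generated nilpotent groups. -/

section Noetherian

open scoped commutatorElement

variable {G : Type*} [Group G]

/-! For an endomorphism of a finitely generated nilpotent group, the Reidemeister number is infinite
exactly when there are infinitely many fixed points (`reidemeisterNumber_eq_top_iff`). Fixed points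
of `φ|_H` are fixed points of `φ`, so infinitude passes from `H` to `N`; the criterion applies to
`H` because subgroups of such groups are finitely generated.

The criterion goes by induction on the length of the lower central series, dividing out its last
term `A`, which is central. On the preimage `F` of the fixed points in `G ⧸ A`, `x ↦ x * (φ x)⁻¹` is
a homomorphism `δ` to `A` with kernel `Fix φ`. Rank-nullity for `δ` restricted to `A` links fixed
points to classes. -/

theorem Subgroup.FG.map_hom {G' : Type*} [Group G'] {K : Subgroup G} (hK : K.FG) (f : G →* G') :
    (K.map f).FG := by
  classical
  obtain ⟨S, rfl⟩ := hK
  exact ⟨S.image f, by rw [Finset.coe_image, MonoidHom.map_closure]⟩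

/-- In a commutative group, finitely generated means Noetherian. -/
theorem Subgroup.fg_of_commGroup {A : Type*} [CommGroup A] [Group.FG A] (K : Subgroup A) :
    K.FG := by
  have : AddGroup.FG (Additive A) := GroupFG.iff_add_fg.mp inferInstance
  have : Module.Finite ℤ (Additive A) := Module.Finite.iff_addGroup_fg.mpr this
  rw [Subgroup.fg_iff_add_fg]
  have := IsNoetherian.noetherian (R := ℤ) (AddSubgroup.toIntSubmodule K.toAddSubgroup)
  rwa [Submodule.fg_iff_addSubgroup_fg] at this

/-- A subgroup is finitely generated if its image under `f` and its intersection with `ker f`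
are. -/
theorem Subgroup.fg_of_map_of_inf_ker {G' : Type*} [Group G'] (f : G →* G') {K : Subgroup G}
    (h₁ : (K.map f).FG) (h₂ : (K ⊓ f.ker).FG) : K.FG := by
  classical
  obtain ⟨S, hS⟩ := h₁
  obtain ⟨T, hT⟩ := h₂
  have hSK : (S : Set G') ⊆ f '' (K : Set G) := by
    rw [← Subgroup.coe_map, ← hS]
    exact Subgroup.subset_closure
  obtain ⟨S', hS', rfl⟩ := Finset.subset_set_image_iff.mp hSK
  refine ⟨S' ∪ T, le_antisymm ?_ fun x hx => ?_⟩
  · rw [Subgroup.closure_le, Finset.coe_union, Set.union_subset_iff]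
    refine ⟨hS', fun x hx => ?_⟩
    have : x ∈ K ⊓ f.ker := hT ▸ Subgroup.subset_closure hx
    exact this.1
  · have hfx : f x ∈ (Subgroup.closure (S' : Set G)).map f := by
      rw [MonoidHom.map_closure, ← Finset.coe_image, hS]
      exact Subgroup.mem_map_of_mem f hx
    obtain ⟨y, hy, hyx⟩ := hfx
    have hyK : y ∈ K := (Subgroup.closure_le K).mpr hS' hy
    have hz : y⁻¹ * x ∈ K ⊓ f.ker :=
      ⟨K.mul_mem (K.inv_mem hyK) hx, by simp [hyx]⟩
    rw [← hT] at hz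
    have hy' := Subgroup.closure_mono (Finset.coe_subset.mpr (Finset.subset_union_left (s₂ := T))) hy
    have hz' :=
      Subgroup.closure_mono (Finset.coe_subset.mpr (Finset.subset_union_right (s₁ := S'))) hz
    simpa using Subgroup.mul_mem _ hy' hz'

/-- If `A = ⁅B, G⁆` is central, `G` is finitely generated, and `B` is finitely generated
modulo `A`, then `A` is finitely generated. -/
theorem Subgroup.fg_commutator_top [Group.FG G] {B : Subgroup G}
    (hc : ⁅B, (⊤ : Subgroup G)⁆ ≤ Subgroup.center G) {S : Finset G}
    (hS : B = Subgroup.closure S ⊔ ⁅B, (⊤ : Subgroup G)⁆) : ⁅B, (⊤ : Subgroup G)⁆.FG := by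
  classical
  obtain ⟨T, hT⟩ := Group.fg_def.mp ‹Group.FG G›
  have hcB : ∀ b ∈ B, ∀ g y : G, y * ⁅b, g⁆ = ⁅b, g⁆ * y := fun b hb g y =>
    Subgroup.mem_center_iff.mp (hc (Subgroup.commutator_mem_commutator hb (Subgroup.mem_top g))) y
  -- Commutators of `B` with `G` are central, so the bracket is bilinear, and brackets of generators
  -- will generate.
  have hmul_right : ∀ b ∈ B, ∀ g h : G, ⁅b, g * h⁆ = ⁅b, g⁆ * ⁅b, h⁆ := fun b hb g h => by
    have : ⁅b, g * h⁆ = ⁅b, g⁆ * (g * ⁅b, h⁆ * g⁻¹) := by simp only [commutatorElement_def]; group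
    rw [this, hcB b hb h g]; group
  have hmul_left : ∀ b ∈ B, ∀ c ∈ B, ∀ g : G, ⁅b * c, g⁆ = ⁅b, g⁆ * ⁅c, g⁆ := fun b hb c hcc g => by
    have : ⁅b * c, g⁆ = (b * ⁅c, g⁆ * b⁻¹) * ⁅b, g⁆ := by simp only [commutatorElement_def]; group
    rw [this, hcB c hcc g b, mul_inv_cancel_right, hcB b hb g]
  set K : Subgroup G := Subgroup.closure (S.product T |>.image fun p => ⁅p.1, p.2⁆ : Finset G)
    with hK
  have hSB : (S : Set G) ⊆ B := fun s hs => by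
    rw [hS]; exact Subgroup.mem_sup_left (Subgroup.subset_closure hs)
  have hst : ∀ s ∈ S, ∀ g : G, ⁅s, g⁆ ∈ K := fun s hs g => by
    have hg : g ∈ Subgroup.closure (T : Set G) := hT ▸ Subgroup.mem_top g
    induction hg using Subgroup.closure_induction with
    | mem t ht =>
      refine Subgroup.subset_closure ?_
      rw [Finset.mem_coe, Finset.mem_image]
      exact ⟨(s, t), Finset.mem_product.mpr ⟨hs, ht⟩, rfl⟩
    | one => simp
    | mul x y _ _ hx hy => rw [hmul_right s (hSB hs)]; exact K.mul_mem hx hy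
    | inv x _ hx =>
      have := hmul_right s (hSB hs) x x⁻¹
      rw [mul_inv_cancel, commutatorElement_one_right] at this
      rw [← inv_eq_of_mul_eq_one_right this.symm]
      exact K.inv_mem hx
  have hsg : ∀ s ∈ Subgroup.closure (S : Set G), ∀ g : G, ⁅s, g⁆ ∈ K := fun s hs g => by
    have hSB' : Subgroup.closure (S : Set G) ≤ B := (Subgroup.closure_le B).mpr hSB
    induction hs using Subgroup.closure_induction with
    | mem s hs => exact hst s hs g
    | one => simp
    | mul x y hxS hyS hx hy =>
      rw [hmul_left x (hSB' hxS) y (hSB' hyS)]; exact K.mul_mem hx hy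
    | inv x hxS hx =>
      have := hmul_left x (hSB' hxS) x⁻¹ (B.inv_mem (hSB' hxS)) g
      rw [mul_inv_cancel, commutatorElement_one_left] at this
      rw [← inv_eq_of_mul_eq_one_right this.symm]
      exact K.inv_mem hx
  refine ⟨_, hK.symm.trans (le_antisymm ?_ ?_)⟩
  · rw [hK, Subgroup.closure_le]
    intro x hx
    rw [Finset.mem_coe, Finset.mem_image] at hx
    obtain ⟨p, hp, rfl⟩ := hx
    exact Subgroup.commutator_mem_commutator (hSB (Finset.mem_product.mp hp).1) (Subgroup.mem_top _)
  · rw [Subgroup.commutator_le]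
    intro b hb g _
    have hb' := hb
    rw [hS] at hb'
    have hAn : ⁅B, (⊤ : Subgroup G)⁆.Normal :=
      ⟨fun n hn g => by rw [Subgroup.mem_center_iff.mp (hc hn) g]; simpa using hn⟩
    obtain ⟨s, hs, a, ha, rfl⟩ := Subgroup.mem_sup_of_normal_right.mp hb'
    have haB : a ∈ B := hS ▸ Subgroup.mem_sup_right ha
    have hag : ⁅a, g⁆ = 1 := commutatorElement_eq_one_iff_mul_comm.mpr
      (Subgroup.mem_center_iff.mp (hc ha) g).symm
    rw [hmul_left s ((Subgroup.closure_le B).mpr hSB hs) a haB, hag, mul_one]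
    exact hsg s hs g

end Noetherian

theorem lowerCentralSeries_le_center {G : Type*} [Group G] {n : ℕ}
    (h : (⊤ : Subgroup G).lowerCentralSeries (n + 1) = ⊥) :
    (⊤ : Subgroup G).lowerCentralSeries n ≤ Subgroup.center G := by
  rw [Subgroup.lowerCentralSeries_succ] at h
  intro x hx
  rw [Subgroup.mem_center_iff]
  intro g
  have : x * g * x⁻¹ * g⁻¹ ∈ (⊥ : Subgroup G) :=
    h ▸ Subgroup.commutator_mem_commutator hx (Subgroup.mem_top g)
  exact (commutatorElement_eq_one_iff_mul_comm.mp (Subgroup.mem_bot.mp this)).symm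

theorem lowerCentralSeries_quotient_eq_bot {G : Type*} [Group G] (n : ℕ) :
    (⊤ : Subgroup (G ⧸ (⊤ : Subgroup G).lowerCentralSeries n)).lowerCentralSeries n = ⊥ := by
  have := Subgroup.map_lowerCentralSeries (⊤ : Subgroup G)
    (QuotientGroup.mk' ((⊤ : Subgroup G).lowerCentralSeries n)) n
  rw [Subgroup.map_top_of_surjective _ (QuotientGroup.mk'_surjective _)] at this
  rw [← this, eq_bot_iff, Subgroup.map_le_iff_le_comap, MonoidHom.comap_bot, QuotientGroup.ker_mk']

theorem Subgroup.fg_of_le_center {G : Type*} [Group G] {A K : Subgroup G} (hA : A.FG)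
    (hc : A ≤ Subgroup.center G) (hK : K ≤ A) : K.FG := by
  let _ : CommGroup A :=
    { (inferInstance : Group A) with
      mul_comm := fun a b => Subtype.ext (Subgroup.mem_center_iff.mp (hc b.2) a) }
  have : Group.FG A := (Group.fg_iff_subgroup_fg A).mpr hA
  have := (Subgroup.fg_of_commGroup (K.subgroupOf A)).map_hom A.subtype
  rwa [Subgroup.subgroupOf_map_subtype, inf_eq_left.mpr hK] at this

/-- Subgroups of finitely generated nilpotent groups are finitely generated. -/
theorem Subgroup.fg_of_lowerCentralSeries_eq_bot (n : ℕ) : ∀ {G : Type*} [Group G] [Group.FG G],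
    (⊤ : Subgroup G).lowerCentralSeries n = ⊥ → ∀ K : Subgroup G, K.FG := by
  induction n with
  | zero =>
    intro G _ _ h K
    rw [Subgroup.lowerCentralSeries_zero] at h
    rw [eq_bot_iff.mpr ((le_top : K ≤ ⊤).trans h.le)]
    exact Subgroup.FG.bot
  | succ n ih =>
    intro G _ _ h K
    set A := (⊤ : Subgroup G).lowerCentralSeries n with hA
    have hc : A ≤ Subgroup.center G := lowerCentralSeries_le_center h
    have hQ : ∀ K : Subgroup (G ⧸ A), K.FG := ih (lowerCentralSeries_quotient_eq_bot n)
    have hAfg : A.FG := by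
      -- If `n = 0` then `A` is `G` itself. Otherwise `A = ⁅B, G⁆`, and `B` is finitely generated
      -- modulo `A` by induction.
      cases n with
      | zero => exact Group.fg_def.mp ‹_›
      | succ m =>
        classical
        set B := (⊤ : Subgroup G).lowerCentralSeries m with hB
        obtain ⟨S, hS⟩ := hQ (B.map (QuotientGroup.mk' A))
        have hSB : (S : Set (G ⧸ A)) ⊆ QuotientGroup.mk' A '' (B : Set G) := by
          rw [← Subgroup.coe_map, ← hS]
          exact Subgroup.subset_closure
        obtain ⟨S', hS', rfl⟩ := Finset.subset_set_image_iff.mp hSB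
        refine Subgroup.fg_commutator_top hc (S := S') ?_
        have hAB : A ≤ B := Subgroup.lowerCentralSeries_antitone _ (Nat.le_succ m)
        rw [Finset.coe_image, ← MonoidHom.map_closure, Subgroup.map_eq_map_iff,
          QuotientGroup.ker_mk', sup_eq_left.mpr hAB] at hS
        exact hS.symm
    refine Subgroup.fg_of_map_of_inf_ker (QuotientGroup.mk' A) (hQ _) ?_
    rw [QuotientGroup.ker_mk']
    exact Subgroup.fg_of_le_center hAfg hc inf_le_right

/-! ### Reidemeister numbers and fixed points. -/

section Reidemeister

theorem Module.finite_int_iff_finrank_eq_zero {M : Type*} [AddCommGroup M] [Module.Finite ℤ M] :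
    Finite M ↔ Module.finrank ℤ M = 0 := by
  rw [Module.finrank_eq_zero_iff_isTorsion]
  refine ⟨fun _ x => ?_, fun h => Module.finite_of_fg_torsion M h⟩
  exact ⟨⟨(Nat.card M : ℤ), mem_nonZeroDivisors_of_ne_zero (by exact_mod_cast Nat.card_pos.ne')⟩, by
    simp [Submonoid.smul_def]⟩

/-- By rank-nullity kernel and cokernel have equal rank, and finiteness means rank zero. -/
theorem LinearMap.finite_ker_iff_finite_quotient_range {M : Type*} [AddCommGroup M]
    [Module.Finite ℤ M] (l : M →ₗ[ℤ] M) :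
    Finite (LinearMap.ker l) ↔ Finite (M ⧸ LinearMap.range l) := by
  rw [Module.finite_int_iff_finrank_eq_zero, Module.finite_int_iff_finrank_eq_zero]
  have h₁ := l.quotKerEquivRange.finrank_eq
  have h₂ := (LinearMap.range l).finrank_quotient_add_finrank
  have h₃ := (LinearMap.ker l).finrank_quotient_add_finrank
  lia

/-- An endomorphism of a finitely generated abelian group has finite kernel if and only if its
image has finite index. -/
theorem MonoidHom.finite_ker_iff_finiteIndex_range {A : Type*} [Group A] [Group.FG A]
    (hA : ∀ a b : A, a * b = b * a) (ψ : A →* A) : Finite ψ.ker ↔ ψ.range.FiniteIndex := by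
  let _ : CommGroup A := { (inferInstance : Group A) with mul_comm := hA }
  have : AddGroup.FG (Additive A) := GroupFG.iff_add_fg.mp inferInstance
  have : Module.Finite ℤ (Additive A) := Module.Finite.iff_addGroup_fg.mpr this
  have key := LinearMap.finite_ker_iff_finite_quotient_range (MonoidHom.toAdditive ψ).toIntLinearMap
  rw [Subgroup.finiteIndex_iff_finite_quotient]
  exact key

/-- `F` is a finite union of cosets of `g.ker`, and `f` maps each to a translate of `f '' g.ker`. -/
theorem Set.finite_range_of_finite_image_ker {F B Q : Type*} [Group F] [Group B] [Group Q]
    [Finite B] (f : F →* Q) (g : F →* B) (h : (f '' (g.ker : Set F)).Finite) :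
    (Set.range f).Finite := by
  have hfin : (⋃ b : B, (fun q => f (Function.invFun g b) * q) '' (f '' (g.ker : Set F))).Finite :=
    Set.finite_iUnion fun b => h.image _
  refine hfin.subset ?_
  rintro _ ⟨x, rfl⟩
  have hx : g (Function.invFun g (g x)) = g x := Function.invFun_eq ⟨x, rfl⟩
  refine Set.mem_iUnion.mpr ⟨g x, f ((Function.invFun g (g x))⁻¹ * x), ⟨_, ?_, rfl⟩, ?_⟩
  · simp [MonoidHom.mem_ker, hx]
  · simp

variable {G : Type*} [Group G]

/-- The preimage in `G` of the fixed points of the map induced by `φ` on `G ⧸ A`. -/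
def fixedMod (φ : G →* G) (A : Subgroup G) (hc : A ≤ Subgroup.center G) : Subgroup G where
  carrier := {x | x * (φ x)⁻¹ ∈ A}
  one_mem' := by simp
  mul_mem' := by
    intro x y hx hy
    have : x * y * (φ (x * y))⁻¹ = x * (φ x)⁻¹ * (y * (φ y)⁻¹) := by
      rw [map_mul, mul_inv_rev]
      have := Subgroup.mem_center_iff.mp (hc hy) ((φ x)⁻¹)
      calc x * y * ((φ y)⁻¹ * (φ x)⁻¹) = x * (y * (φ y)⁻¹ * (φ x)⁻¹) := by group
        _ = _ := by rw [← this]; group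
    rw [Set.mem_ofPred_eq, this]
    exact A.mul_mem hx hy
  inv_mem' := by
    intro x hx
    have h := Subgroup.mem_center_iff.mp (hc hx) x⁻¹
    have : x⁻¹ * (φ x⁻¹)⁻¹ = (x * (φ x)⁻¹)⁻¹ := by
      rw [inv_mul_cancel_left] at h
      have h' : φ x = x * φ x * x⁻¹ := by rw [← inv_inj, h]; group
      calc x⁻¹ * (φ x⁻¹)⁻¹ = x⁻¹ * φ x := by rw [map_inv, inv_inv]
        _ = x⁻¹ * (x * φ x * x⁻¹) := congrArg _ h'
        _ = _ := by group
    rw [Set.mem_ofPred_eq, this]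
    exact A.inv_mem hx

/-- The homomorphism `x ↦ x * (φ x)⁻¹` with values in a central subgroup. -/
def twistedDiff (φ : G →* G) (A : Subgroup G) (hc : A ≤ Subgroup.center G) :
    fixedMod φ A hc →* A where
  toFun x := ⟨x * (φ x)⁻¹, x.2⟩
  map_one' := by simp
  map_mul' x y := by
    refine Subtype.ext ?_
    have := Subgroup.mem_center_iff.mp (hc y.2) ((φ x)⁻¹)
    simp only [Subgroup.coe_mul, map_mul, mul_inv_rev]
    calc (x : G) * y * ((φ y)⁻¹ * (φ x)⁻¹) = x * (y * (φ y)⁻¹ * (φ x)⁻¹) := by group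
      _ = _ := by rw [← this]; group

theorem le_fixedMod {φ : G →* G} {A : Subgroup G} (hc : A ≤ Subgroup.center G)
    (hA : A ≤ A.comap φ) : A ≤ fixedMod φ A hc :=
  fun _ ha => A.mul_mem ha (A.inv_mem (hA ha))

/-- The inductive step: `hQ` is the criterion for `G ⧸ A`. Below, `F` is `fixedMod φ A hc` and `F /
A` is the fixed-point group of `φQ`. -/
theorem finite_twistedConj_iff_of_central (φ : G →* G) (A : Subgroup G) [A.Normal]
    (hc : A ≤ Subgroup.center G) (hA : A ≤ A.comap φ) (hfg : A.FG)
    (hQ : Finite (Quotient (twistedConjSetoid (QuotientGroup.map A A φ hA))) ↔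
      {x | QuotientGroup.map A A φ hA x = x}.Finite) :
    Finite (Quotient (twistedConjSetoid φ)) ↔ {x | φ x = x}.Finite := by
  set φQ := QuotientGroup.map A A φ hA with hφQ
  set δ := twistedDiff φ A hc with hδ
  have hδ_apply : ∀ x, (δ x : G) = x * (φ x)⁻¹ := fun _ => rfl
  set ι := Subgroup.inclusion (le_fixedMod hc hA) with hι
  set f : fixedMod φ A hc →* G ⧸ A := (QuotientGroup.mk' A).comp (fixedMod φ A hc).subtype with hf
  have : Group.FG A := (Group.fg_iff_subgroup_fg A).mpr hfg
  have hab := MonoidHom.finite_ker_iff_finiteIndex_range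
    (fun a b : A => Subtype.ext (Subgroup.mem_center_iff.mp (hc b.2) a)) (δ.comp ι)
  have hfixQ : {x | φQ x = x} = Set.range f := by
    ext x
    obtain ⟨x, rfl⟩ := QuotientGroup.mk_surjective x
    rw [Set.mem_ofPred_eq, hφQ, QuotientGroup.map_mk]
    constructor
    · intro h
      refine ⟨⟨x, ?_⟩, rfl⟩
      have h' := QuotientGroup.eq.mp h.symm
      change x * (φ x)⁻¹ ∈ A
      rw [Subgroup.Normal.mem_comm_iff inferInstance, ← inv_mem_iff]
      simpa using h'
    · rintro ⟨y, hy⟩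
      have hyA : (y : G) * (φ y)⁻¹ ∈ A := y.2
      have hxy : (y : G ⧸ A) = x := hy
      have h1 : (QuotientGroup.mk (φ x) : G ⧸ A) = QuotientGroup.mk (φ y) := by
        rw [← QuotientGroup.map_mk A A φ hA x, ← hxy, QuotientGroup.map_mk]
      rw [h1, ← hxy, QuotientGroup.eq, Subgroup.Normal.mem_comm_iff inferInstance]
      exact hyA
  have hkerf : f.ker = ι.range := by
    ext x
    rw [MonoidHom.mem_ker, hf, MonoidHom.comp_apply, QuotientGroup.mk'_apply,
      QuotientGroup.eq_one_iff]
    exact ⟨fun h => ⟨⟨x, h⟩, rfl⟩, by rintro ⟨a, rfl⟩; exact a.2⟩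
  have hfix_ker : ∀ x : fixedMod φ A hc, δ x = 1 ↔ φ x = x := fun x => by
    rw [Subtype.ext_iff, hδ_apply, Subgroup.coe_one, mul_inv_eq_one, eq_comm]
  have hfix_mem : ∀ x, φ x = x → x ∈ fixedMod φ A hc := fun x hx => by
    change x * (φ x)⁻¹ ∈ A
    simp [hx]
  constructor
  · intro hR
    have hRQ : Finite (Quotient (twistedConjSetoid φQ)) := by
      refine Finite.of_surjective
        (Quotient.map' (s₁ := twistedConjSetoid φ) (QuotientGroup.mk' A) ?_) ?_
      · rintro x y ⟨z, rfl⟩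
        exact ⟨QuotientGroup.mk' A z, by simp [hφQ]⟩
      · rintro ⟨q⟩
        obtain ⟨x, rfl⟩ := QuotientGroup.mk'_surjective A q
        exact ⟨Quotient.mk _ x, rfl⟩
    have hF : (Set.range f).Finite := hfixQ ▸ hQ.mp hRQ
    -- Elements of `A` that are `φ`-conjugate in `G` differ by a value of `δ`, so `A ⧸ δ.range`
    -- injects into the classes.
    have hδind : δ.range.FiniteIndex := by
      have : Finite (A ⧸ δ.range) := by
        refine Finite.of_injective (β := Quotient (twistedConjSetoid φ))
          (fun a => Quotient.mk _ (Quotient.out a : A).1) fun a b hab' => ?_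
        obtain ⟨z, hz⟩ := Quotient.exact hab'
        rw [← QuotientGroup.out_eq' a, ← QuotientGroup.out_eq' b, QuotientGroup.eq]
        set a' : A := Quotient.out a
        set b' : A := Quotient.out b
        have hzab : z * (φ z)⁻¹ = (b'⁻¹ * a' : A) := by
          rw [Subgroup.coe_mul, Subgroup.coe_inv, hz, Subgroup.mem_center_iff.mp (hc b'.2) z]
          group
        rw [← inv_mem_iff, mul_inv_rev, inv_inv]
        exact ⟨⟨z, show z * (φ z)⁻¹ ∈ A from hzab ▸ Subtype.prop _⟩, Subtype.ext hzab⟩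
      exact Subgroup.finiteIndex_of_finite_quotient
    have hιind : ι.range.FiniteIndex := by
      rw [← hkerf]
      have : Finite f.range := hF
      exact Subgroup.finiteIndex_ker f
    have hind : (δ.comp ι).range.FiniteIndex := by
      rw [MonoidHom.range_comp]
      refine ⟨?_⟩
      rw [Subgroup.index_map]
      refine mul_ne_zero ?_ hδind.index_ne_zero
      exact (Subgroup.finiteIndex_of_le (le_sup_left : ι.range ≤ _ ⊔ δ.ker)).index_ne_zero
    have hker : Finite (δ.comp ι).ker := hab.mpr hind
    have : Finite f.range := hF
    -- `Fix φ = δ.ker` has finite image in `G ⧸ A` and meets `A` in the finite group `(δ.comp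
    -- ι).ker`.
    have hfin : (Set.range δ.ker.subtype).Finite := by
      refine Set.finite_range_of_finite_image_ker δ.ker.subtype
        (f.rangeRestrict.comp δ.ker.subtype) ?_
      refine (Set.finite_range fun a : (δ.comp ι).ker => ι a).subset ?_
      rintro _ ⟨x, hx, rfl⟩
      have hxf : (x : fixedMod φ A hc) ∈ f.ker := congrArg Subtype.val hx
      rw [hkerf] at hxf
      obtain ⟨a, ha⟩ := hxf
      exact ⟨⟨a, by rw [MonoidHom.mem_ker, MonoidHom.comp_apply, ha]; exact x.2⟩, ha⟩
    refine (hfin.image Subtype.val).subset fun x hx => ?_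
    exact ⟨⟨x, hfix_mem x hx⟩, ⟨⟨_, (hfix_ker ⟨x, hfix_mem x hx⟩).mpr hx⟩, rfl⟩, rfl⟩
  · intro hfix
    have hker : Finite (δ.comp ι).ker := by
      refine @Finite.of_injective _ {x | φ x = x} hfix.to_subtype
        (fun a => ⟨a.1.1, (hfix_ker (ι a.1)).mp a.2⟩) fun a b h => ?_
      have h' : (a.1 : G) = b.1 := Subtype.mk.inj h
      exact Subtype.ext (Subtype.ext h')
    have hind := hab.mp hker
    -- If `δ x = δ a` with `a ∈ A`, then `x * a⁻¹` is fixed by `φ` with the same image in `G ⧸ A`.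
    -- Such `x` form a subgroup of finite index in `F`.
    have hF : (Set.range f).Finite := by
      have : (δ.comp ι).range.Normal :=
        ⟨fun n hn g => by
          rwa [show g * n = n * g from Subtype.ext (Subgroup.mem_center_iff.mp (hc n.2) g),
            mul_inv_cancel_right]⟩
      have := Subgroup.finite_quotient_of_finiteIndex (H := (δ.comp ι).range)
      refine Set.finite_range_of_finite_image_ker f
        ((QuotientGroup.mk' (δ.comp ι).range).comp δ) ?_
      refine (hfix.image (QuotientGroup.mk' A)).subset ?_
      rintro _ ⟨x, hx, rfl⟩
      obtain ⟨a, ha⟩ := (QuotientGroup.eq_one_iff _).mp hx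
      refine ⟨(x * (ι a)⁻¹ : fixedMod φ A hc), ?_, ?_⟩
      · refine (hfix_ker _).mp ?_
        rw [map_mul, map_inv, ← ha, MonoidHom.comp_apply, mul_inv_cancel]
      · have : f (ι a) = 1 := MonoidHom.mem_ker.mp (hkerf ▸ ⟨a, rfl⟩)
        change f (x * (ι a)⁻¹) = f x
        rw [map_mul, map_inv, this, inv_one, mul_one]
    have hRQ := hQ.mpr (hfixQ ▸ hF)
    -- A class is determined by its class in `G ⧸ A` and a correction in `A`, which matters only
    -- modulo `δ(A)`.
    refine Finite.of_surjective (α := Quotient (twistedConjSetoid φQ) × (A ⧸ (δ.comp ι).range))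
      (fun p => Quotient.mk _ ((Quotient.out (Quotient.out p.1)) * (Quotient.out p.2 : A).1)) ?_
    intro q
    obtain ⟨x, rfl⟩ := Quotient.exists_rep q
    let p : Quotient (twistedConjSetoid φQ) := Quotient.mk _ (QuotientGroup.mk x)
    set y : G := Quotient.out (Quotient.out p) with hy
    have hyp : (QuotientGroup.mk y : G ⧸ A) = Quotient.out p := Quotient.out_eq _
    obtain ⟨z, hz⟩ : (twistedConjSetoid φQ).r (QuotientGroup.mk x) (QuotientGroup.mk y) := by
      rw [hyp]
      exact (twistedConjSetoid φQ).symm' (Quotient.mk_out (s := twistedConjSetoid φQ) _)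
    obtain ⟨z, rfl⟩ := QuotientGroup.mk_surjective z
    have ha : (z * y * (φ z)⁻¹)⁻¹ * x ∈ A := by
      rw [← QuotientGroup.eq, hz]
      rfl
    set a : A := ⟨_, ha⟩ with ha_def
    set a' : A := Quotient.out (QuotientGroup.mk a : A ⧸ (δ.comp ι).range) with ha'
    obtain ⟨b, hb⟩ : a'⁻¹ * a ∈ (δ.comp ι).range :=
      QuotientGroup.eq.mp (QuotientGroup.out_eq' _)
    have hb' : (b : G) * (φ b)⁻¹ = (a' : G)⁻¹ * ((z * y * (φ z)⁻¹)⁻¹ * x) :=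
      congrArg Subtype.val hb
    refine ⟨(p, QuotientGroup.mk a), (Quotient.sound ?_).symm⟩
    refine ⟨z * b, ?_⟩
    change x = z * b * (y * a') * (φ (z * b))⁻¹
    have hbc := Subgroup.mem_center_iff.mp (hc b.2)
    have hac := Subgroup.mem_center_iff.mp (hc a'.2)
    calc x = z * y * (φ z)⁻¹ * (a' * (b * (φ b)⁻¹)) := by rw [hb']; group
      _ = z * (y * ((φ z)⁻¹ * a') * b) * (φ b)⁻¹ := by group
      _ = z * b * (y * a') * (φ (z * b))⁻¹ := by
        rw [hac, hbc, map_mul, Subgroup.mem_center_iff.mp (hc (hA b.2)) (φ z)]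
        group

theorem finite_twistedConj_iff_finite_fixedPoints (n : ℕ) : ∀ {G : Type*} [Group G] [Group.FG G],
    (⊤ : Subgroup G).lowerCentralSeries n = ⊥ → ∀ φ : G →* G,
    (Finite (Quotient (twistedConjSetoid φ)) ↔ {x | φ x = x}.Finite) := by
  induction n with
  | zero =>
    intro G _ _ h φ
    have : Subsingleton G := Subgroup.subsingleton_iff.mp (subsingleton_of_bot_eq_top h.symm)
    exact iff_of_true inferInstance (Set.toFinite _)
  | succ n ih =>
    intro G _ _ h φ
    have hA : (⊤ : Subgroup G).lowerCentralSeries n ≤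
        ((⊤ : Subgroup G).lowerCentralSeries n).comap φ := by
      rw [← Subgroup.map_le_iff_le_comap, Subgroup.map_lowerCentralSeries]
      exact Subgroup.lowerCentralSeries_mono n le_top
    exact finite_twistedConj_iff_of_central φ _ (lowerCentralSeries_le_center h) hA
      (Subgroup.fg_of_lowerCentralSeries_eq_bot (n + 1) h _)
      (ih (lowerCentralSeries_quotient_eq_bot n) _)

theorem reidemeisterNumber_eq_top_iff [Group.FG G] [Group.IsNilpotent G] (φ : G →* G) :
    reidemeisterNumber φ = ⊤ ↔ {x | φ x = x}.Infinite := by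
  rw [reidemeisterNumber, ENat.card_eq_top, ← not_finite_iff_infinite, Set.Infinite,
    finite_twistedConj_iff_finite_fixedPoints _ Subgroup.lowerCentralSeries_nilpotencyClass]

end Reidemeister

theorem mainTheorem7 {N : Type*} [Group N] [Group.FG N] [Group.IsNilpotent N]
    (htf : ∀ g : N, g ≠ 1 → ¬ IsOfFinOrder g)
    (φ : N →* N) (H : Subgroup N) (hH : H.map φ ≤ H)
    (hR : reidemeisterNumber (restrictEnd φ H hH) = ⊤) :
    reidemeisterNumber φ = ⊤ := by
  have : Group.FG H := (Group.fg_iff_subgroup_fg H).mpr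
    (Subgroup.fg_of_lowerCentralSeries_eq_bot _ Subgroup.lowerCentralSeries_nilpotencyClass H)
  rw [reidemeisterNumber_eq_top_iff] at hR ⊢
  refine (hR.image Subtype.val_injective.injOn).mono ?_
  rintro _ ⟨x, hx, rfl⟩
  exact congrArg Subtype.val hx
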